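/- Let $\pmb k$ be a field of positive characteristic $p$, and let $d\ge 1$ and $n\ge 3$ be integers with $$\left\lfloor\frac{n(d-1)+3}{2}\right\rfloor\le p .$$ For a positive integer $m$ put $A(m)=\pmb k[x_1,\dots,x_m]/(x_1^d,\dots,x_m^d)$, with the standard grading (every $x_i$ has degree $1$). Then the following statements hold. (1) Let $J$ be the homogeneous ideal $$J=\frac{(x_1^d,\dots,x_{n-1}^d):(x_1+\dots+x_{n-1})^d}{(x_1^d,\dots,x_{n-1}^d)}$$ of $A(n-1)$, and let $\operatorname{mgd} J$ be the least degree $i$ with $J_i\neq 0$ ($\operatorname{mgd} J=\infty$ if $J=0$). Then $$1+\left\lfloor\frac{(n-1)d-(n-1)-d}{2}\right\rfloor\le \operatorname{mgd} J .$$ (2) If $\pmb k$ is infinite, then $A=A(n)$ has the weak Lefschetz property: there is a linear form $L\in A_1$ such that for every $i$ the multiplication map $L\colon A_i\to A_{i+1}$ has maximal rank, that is, is injective or surjective. -/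

import Mathlib

open MvPolynomial

noncomputable section

/-! ### Graded algebras: minimal generator degree and the weak Lefschetz property -/

section Graded

variable {k A : Type*} [Field k] [CommRing A] [Algebra k A]

/-- `i₀ ≤ mgd J` for an ideal `J` of the graded algebra `A = ⨁ 𝒜 i`: every component `J ∩ 𝒜 i`
with `i < i₀` is zero. (The degrees of `A` are natural numbers, but `i₀` may be negative. If `J = 0`
then the condition holds for all `i₀`, that is, `mgd 0 = ∞`.) -/
def LeMgd (𝒜 : ℕ → Submodule k A) (i₀ : ℤ) (J : Ideal A) : Prop :=
  ∀ i : ℕ, (i : ℤ) < i₀ → ∀ u ∈ J, u ∈ 𝒜 i → u = 0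

/-- Multiplication by a linear form `L`, as a `k`-linear map from degree `i` to degree `i + 1`. -/
def mulLinearForm (𝒜 : ℕ → Submodule k A) [GradedAlgebra 𝒜] (L : 𝒜 1) (i : ℕ) :
    𝒜 i →ₗ[k] 𝒜 (i + 1) :=
  (LinearMap.mulLeft k (L : A)).restrict fun u hu => by
    have h := SetLike.mul_mem_graded L.2 hu
    rw [add_comm] at h
    exact h

/-- `L` is a Lefschetz element: all maps `L : A_i → A_{i+1}` have maximal rank, that is, each of
them is injective or surjective. -/
def IsLefschetzElement (𝒜 : ℕ → Submodule k A) [GradedAlgebra 𝒜] (L : 𝒜 1) : Prop :=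
  ∀ i : ℕ, Function.Injective (mulLinearForm 𝒜 L i) ∨ Function.Surjective (mulLinearForm 𝒜 L i)

/-- The weak Lefschetz property. -/
def HasWLP (𝒜 : ℕ → Submodule k A) [GradedAlgebra 𝒜] : Prop :=
  ∃ L : 𝒜 1, IsLefschetzElement 𝒜 L

end Graded

/-! ### The monomial complete intersection `k[x_1, …, x_n] / (x_1^{a_1}, …, x_n^{a_n})` -/

section CompleteIntersection

variable (k : Type*) [Field k] (n : ℕ) (a : Fin n → ℕ)

/-- The ideal `(x_1^{a_1}, …, x_n^{a_n})`. -/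
def powIdeal : Ideal (MvPolynomial (Fin n) k) :=
  Ideal.span (Set.range fun i : Fin n => (X i : MvPolynomial (Fin n) k) ^ a i)

/-- The algebra `A(k, n, a) = k[x_1, …, x_n] / (x_1^{a_1}, …, x_n^{a_n})`. -/
abbrev CIAlg : Type _ := MvPolynomial (Fin n) k ⧸ powIdeal k n a

/-- The degree `i` component of `A(k, n, a)`: the classes of homogeneous polynomials of degree `i`,
where all variables have degree one. -/
def ciGrading (i : ℕ) : Submodule k (CIAlg k n a) :=
  (homogeneousSubmodule (Fin n) k i).map (Ideal.Quotient.mkₐ k (powIdeal k n a)).toLinearMap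

theorem mk_mem_ciGrading {i : ℕ} {f : MvPolynomial (Fin n) k}
    (hf : f ∈ homogeneousSubmodule (Fin n) k i) :
    Ideal.Quotient.mk (powIdeal k n a) f ∈ ciGrading k n a i :=
  ⟨f, hf, rfl⟩

section

attribute [local instance] MvPolynomial.gradedAlgebra

theorem powIdeal_isHomogeneous :
    (powIdeal k n a).IsHomogeneous (homogeneousSubmodule (Fin n) k) := by
  refine Ideal.homogeneous_span _ _ ?_
  rintro _ ⟨i, rfl⟩
  exact ⟨a i, by simpa using (isHomogeneous_X k i).pow (a i)⟩

instance ciGrading_gradedMonoid : SetLike.GradedMonoid (ciGrading k n a) where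
  one_mem := ⟨1, isHomogeneous_one _ _, rfl⟩
  mul_mem := by
    rintro i j _ _ ⟨f, hf, rfl⟩ ⟨g, hg, rfl⟩
    exact ⟨f * g, IsHomogeneous.mul hf hg, rfl⟩

/-- The class map in degree `i`. -/
def ciComponentMap (i : ℕ) : homogeneousSubmodule (Fin n) k i →+ ciGrading k n a i where
  toFun f := ⟨Ideal.Quotient.mk _ f.1, mk_mem_ciGrading k n a f.2⟩
  map_zero' := by ext; simp
  map_add' f g := by ext; simp

/-- The map that sends a polynomial to the classes of its homogeneous components. -/
def ciDecomposeAux : MvPolynomial (Fin n) k →+ DirectSum ℕ fun i => ciGrading k n a i :=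
  (DirectSum.map (ciComponentMap k n a)).comp
    (DirectSum.decomposeAddEquiv (homogeneousSubmodule (Fin n) k)).toAddMonoidHom

theorem ciDecomposeAux_of_mem {i : ℕ} {f : MvPolynomial (Fin n) k}
    (hf : f ∈ homogeneousSubmodule (Fin n) k i) :
    ciDecomposeAux k n a f = DirectSum.of (fun i => ciGrading k n a i) i
      ⟨Ideal.Quotient.mk _ f, mk_mem_ciGrading k n a hf⟩ := by
  simp only [ciDecomposeAux, AddMonoidHom.comp_apply]
  change DirectSum.map _ (DirectSum.decompose (homogeneousSubmodule (Fin n) k) f) = _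
  rw [DirectSum.decompose_of_mem _ hf, DirectSum.map_of]
  rfl

theorem ciDecomposeAux_eq_zero {f : MvPolynomial (Fin n) k} (hf : f ∈ powIdeal k n a) :
    ciDecomposeAux k n a f = 0 := by
  refine DFinsupp.ext fun i => ?_
  change DirectSum.map (ciComponentMap k n a)
    (DirectSum.decompose (homogeneousSubmodule (Fin n) k) f) i = 0
  rw [DirectSum.map_apply]
  ext
  exact Ideal.Quotient.eq_zero_iff_mem.2 (powIdeal_isHomogeneous k n a i hf)

/-- The decomposition of an element of `A(k, n, a)` into its homogeneous components. -/
def ciDecompose : CIAlg k n a →+ DirectSum ℕ fun i => ciGrading k n a i :=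
  QuotientAddGroup.lift (powIdeal k n a).toAddSubgroup (ciDecomposeAux k n a)
    (show (powIdeal k n a).toAddSubgroup ≤ (ciDecomposeAux k n a).ker from
      fun _ hf => ciDecomposeAux_eq_zero k n a hf)

theorem ciDecompose_mk (f : MvPolynomial (Fin n) k) :
    ciDecompose k n a (Ideal.Quotient.mk _ f) = ciDecomposeAux k n a f := rfl

/-- The components `ciGrading k n a i` make `A(k, n, a)` a graded algebra. -/
instance ciGrading_gradedAlgebra : GradedAlgebra (ciGrading k n a) where
  toDecomposition := DirectSum.Decomposition.ofAddHom (ciGrading k n a) (ciDecompose k n a)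
    (by
      refine AddMonoidHom.ext fun x => ?_
      obtain ⟨f, rfl⟩ := Ideal.Quotient.mk_surjective x
      simp only [AddMonoidHom.comp_apply, AddMonoidHom.id_apply, ciDecompose_mk]
      induction f using DirectSum.Decomposition.inductionOn
        (homogeneousSubmodule (Fin n) k) with
      | zero => simp
      | homogeneous f =>
        rw [ciDecomposeAux_of_mem k n a f.2, DirectSum.coeAddMonoidHom_of]
      | add f g hf hg =>
        rw [map_add, map_add, hf, hg, map_add])
    (by
      refine DirectSum.addHom_ext fun i x => ?_
      obtain ⟨_, f, hf, rfl⟩ := x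
      simp only [AddMonoidHom.comp_apply, DirectSum.coeAddMonoidHom_of, AddMonoidHom.id_apply]
      exact ciDecomposeAux_of_mem k n a hf)

end

/-- The ideal `J(k, n, a, γ)` of `A(k, n, a)`, namely
`((x_1^{a_1}, …, x_n^{a_n}) : (x_1 + ⋯ + x_n)^γ) / (x_1^{a_1}, …, x_n^{a_n})`. -/
def colonIdeal (γ : ℕ) : Ideal (CIAlg k n a) :=
  ((powIdeal k n a).colon {(∑ i : Fin n, (X i : MvPolynomial (Fin n) k)) ^ γ}).map
    (Ideal.Quotient.mk (powIdeal k n a))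

/-- `MN(n, a, γ) = 1 + ⌊(|a| - n - γ) / 2⌋` with `|a| = a_1 + ⋯ + a_n`
(division of integers by `2` rounds down, also for negative numerators). -/
def MN (n : ℕ) (a : Fin n → ℕ) (γ : ℕ) : ℤ :=
  1 + ((∑ i, (a i : ℤ)) - n - γ) / 2

/-- The inequality `MN(n, a, γ) ≤ mgd J(k, n, a, γ)`. -/
def StanIneq (γ : ℕ) : Prop :=
  LeMgd (ciGrading k n a) (MN n a γ) (colonIdeal k n a γ)

end CompleteIntersection

end

section WeakLefschetz

variable {k : Type*} [Field k] {n d : ℕ}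

/-! Write `s` for the sum of the variables, `I` for the ideal of `d`-th powers and `N = n(d-1)` for
the socle degree of `A(n)`. Everything rests on one fact (`mem_powIdeal_of_sum_X_mul_mem`): if `N +
2 ≤ 2p`, then `s` is injective on `A(n)` in degrees `i` with `2i < N`. The socle lies in degree `N`,
so a kernel element can be multiplied up to the last degree `i` with `2i < N`. There the
`sl₂`-relations express it as a constant times `s^i`, because the scalars to be inverted have prime
factors below `p`. But `s^(i+1) ∉ I`, its coefficients being multinomials with `i + 1 < p`, so the
constant is zero. For (2), surjectivity in degrees `2i ≥ N` is dual to this injectivity. For (1), a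
class killed by `s^d` in `n - 1` variables yields a class killed by the sum of all `n` variables. -/

theorem mem_powIdeal_iff {a : Fin n → ℕ} {f : MvPolynomial (Fin n) k} :
    f ∈ powIdeal k n a ↔ ∀ e : Fin n →₀ ℕ, (∀ i, e i < a i) → f.coeff e = 0 := by
  have h : powIdeal k n a = Ideal.span ((fun e => monomial e (1 : k)) ''
      Set.range fun i => Finsupp.single i (a i)) := by
    rw [powIdeal, ← Set.range_comp]
    congr 2
    ext1 i
    simp [X_pow_eq_monomial]
  rw [h, mem_ideal_span_monomial_image]
  refine forall_congr' fun e => ?_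
  simp only [Set.mem_range, exists_exists_eq_and, Finsupp.single_le_iff, mem_support_iff]
  rw [← not_imp_not, not_not, not_exists]
  simp only [not_le]

/-! ### The `sl₂`-action -/

/-- The lowering operator of the `sl₂`-action on `k[x_1, …, x_n]` with `x_i^j ↦ j (d - j) x_i^(j-1)`;
the raising operator is multiplication by the sum of the variables. -/
noncomputable def lowering (k : Type*) [Field k] (n d : ℕ) :
    MvPolynomial (Fin n) k →ₗ[k] MvPolynomial (Fin n) k :=
  ∑ i, (((d : k) - 1) • (pderiv i).toLinearMap -
    LinearMap.mulLeft k (X i) ∘ₗ (pderiv i).toLinearMap ∘ₗ (pderiv i).toLinearMap)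

theorem lowering_apply (f : MvPolynomial (Fin n) k) :
    lowering k n d f = ∑ i, (C ((d : k) - 1) * pderiv i f - X i * pderiv i (pderiv i f)) := by
  simp [lowering, LinearMap.sum_apply, smul_eq_C_mul]

theorem coeff_lowering (f : MvPolynomial (Fin n) k) (e : Fin n →₀ ℕ) :
    (lowering k n d f).coeff e =
      ∑ i, ((e i : k) + 1) * (d - (e i + 1)) * f.coeff (e + Finsupp.single i 1) := by
  rw [lowering_apply, coeff_sum]
  refine Finset.sum_congr rfl fun i _ => ?_
  rw [coeff_sub, coeff_C_mul, coeff_X_mul', coeff_pderiv]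
  split_ifs with hi
  · obtain ⟨e', rfl⟩ : ∃ e', e = e' + Finsupp.single i 1 := by
      refine ⟨e - Finsupp.single i 1, (tsub_add_cancel_of_le ?_).symm⟩
      rw [Finsupp.single_le_iff]
      exact Nat.one_le_iff_ne_zero.2 (Finsupp.mem_support_iff.1 hi)
    rw [add_tsub_cancel_right, coeff_pderiv, coeff_pderiv]
    simp only [Finsupp.add_apply, Finsupp.single_eq_same]
    push_cast
    ring
  · rw [Finsupp.notMem_support_iff.1 hi]
    push_cast
    ring

/-- The factor `d - (e i + 1)` vanishes exactly where exponent `d` would drop to `d - 1`, so the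
operator descends to the quotient. -/
theorem lowering_mem_powIdeal {f : MvPolynomial (Fin n) k} (hf : f ∈ powIdeal k n fun _ => d) :
    lowering k n d f ∈ powIdeal k n fun _ => d := by
  rw [mem_powIdeal_iff] at hf ⊢
  intro e he
  rw [coeff_lowering]
  refine Finset.sum_eq_zero fun i _ => ?_
  rcases (Nat.succ_le_of_lt (he i)).eq_or_lt with h | h
  · rw [← h]
    push_cast
    ring
  · rw [hf, mul_zero]
    intro j
    rcases eq_or_ne j i with rfl | hj
    · simpa using h
    · simpa [Finsupp.single_eq_of_ne hj] using he j

theorem lowering_isHomogeneous {f : MvPolynomial (Fin n) k} {m : ℕ} (hf : f.IsHomogeneous (m + 1)) :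
    (lowering k n d f).IsHomogeneous m := by
  intro e he
  rw [coeff_lowering] at he
  obtain ⟨i, -, hi⟩ := Finset.exists_ne_zero_of_sum_ne_zero he
  have := hf (right_ne_zero_of_mul hi)
  rw [map_add] at this
  simpa [Finsupp.weight_single] using this

/-- In each variable the commutator with `X i` is `(d - 1) - 2 X i ∂_i`; Euler's formula sums these
to the weight `N - 2m`. -/
theorem lowering_sum_X_mul {f : MvPolynomial (Fin n) k} {m : ℕ} (hf : f.IsHomogeneous m) :
    lowering k n d ((∑ i, X i) * f) =
      (∑ i, X i) * lowering k n d f + C ((n : k) * (d - 1) - 2 * m) * f := by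
  have hs (i : Fin n) : pderiv i (∑ j, X j : MvPolynomial (Fin n) k) = 1 := by
    rw [map_sum, Finset.sum_eq_single i (fun j _ hj => pderiv_X_of_ne hj) (by simp), pderiv_X_self]
  have hE := hf.sum_X_mul_pderiv
  rw [nsmul_eq_mul] at hE
  simp only [lowering_apply, pderiv_mul, hs, map_add, one_mul]
  rw [Finset.mul_sum, ← sub_eq_iff_eq_add', ← Finset.sum_sub_distrib]
  trans ∑ i : Fin n, (C ((d : k) - 1) * f - 2 * (X i * pderiv i f))
  · refine Finset.sum_congr rfl fun i _ => ?_
    ring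
  · rw [Finset.sum_sub_distrib, ← Finset.mul_sum, ← Finset.mul_sum, hE]
    simp [map_ofNat]
    ring

theorem isHomogeneous_sum_X : (∑ i, X i : MvPolynomial (Fin n) k).IsHomogeneous 1 :=
  IsHomogeneous.sum _ _ _ fun i _ => isHomogeneous_X k i

/-! ### Powers of the sum of the variables -/

/-- The coefficients are multinomials `m! / ∏ (e i)!`, prime to `p`. The induction differentiates
`s^(m+1)` instead of using factorials. -/
theorem coeff_sum_X_pow_ne_zero {p : ℕ} [CharP k p] :
    ∀ {m : ℕ} (_ : m < p) (e : Fin n →₀ ℕ) (_ : e.degree = m),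
      ((∑ i, X i : MvPolynomial (Fin n) k) ^ m).coeff e ≠ 0
  | 0, _, e, he => by
    rw [Finsupp.degree_eq_zero_iff] at he
    simp [he]
  | m + 1, hm, e, he => by
    obtain ⟨i, hi⟩ : ∃ i, e i ≠ 0 := by
      by_contra! h
      simp [Finsupp.degree_eq_sum, h] at he
    obtain ⟨e', rfl⟩ : ∃ e', e = e' + Finsupp.single i 1 :=
      ⟨e - Finsupp.single i 1, (tsub_add_cancel_of_le
        (Finsupp.single_le_iff.2 (Nat.one_le_iff_ne_zero.2 hi))).symm⟩
    have he' : e'.degree = m := by simpa using he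
    have h := coeff_pderiv (i := i) ((∑ i, X i : MvPolynomial (Fin n) k) ^ (m + 1)) e'
    have hs : pderiv i (∑ j, X j : MvPolynomial (Fin n) k) = 1 := by
      rw [map_sum, Finset.sum_eq_single i (fun j _ hj => pderiv_X_of_ne hj) (by simp),
        pderiv_X_self]
    rw [pderiv_pow, hs, mul_one, Nat.add_sub_cancel, ← map_natCast C, coeff_C_mul] at h
    refine left_ne_zero_of_mul (h ▸ mul_ne_zero ?_ (coeff_sum_X_pow_ne_zero (by omega) e' he'))
    rw [Ne, CharP.cast_eq_zero_iff k p]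
    exact Nat.not_dvd_of_pos_of_lt m.succ_pos hm

theorem exists_degree_eq {m : ℕ} (hd : 0 < d) (hm : m ≤ n * (d - 1)) :
    ∃ e : Fin n →₀ ℕ, (∀ i, e i < d) ∧ e.degree = m := by
  induction m with
  | zero => exact ⟨0, by simpa using fun _ => hd, by simp⟩
  | succ m ih =>
    obtain ⟨e, he, hm'⟩ := ih (by omega)
    obtain ⟨i, hi⟩ : ∃ i, e i < d - 1 := by
      by_contra! h
      have := Finset.card_nsmul_le_sum Finset.univ e (d - 1) fun i _ => h i
      rw [← Finsupp.degree_eq_sum, hm'] at this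
      simp at this
      omega
    refine ⟨e + Finsupp.single i 1, fun j => ?_, by simp [hm']⟩
    rcases eq_or_ne j i with rfl | hj
    · simp; omega
    · simpa [Finsupp.single_eq_of_ne hj] using he j

theorem sum_X_pow_notMem {p m : ℕ} [CharP k p] (hd : 0 < d) (hmp : m < p) (hm : m ≤ n * (d - 1)) :
    (∑ i, X i : MvPolynomial (Fin n) k) ^ m ∉ powIdeal k n fun _ => d := fun h => by
  obtain ⟨e, he, hem⟩ := exists_degree_eq hd hm
  exact coeff_sum_X_pow_ne_zero hmp e hem (mem_powIdeal_iff.1 h e he)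

/-! ### Injectivity below the middle degree -/

theorem lowering_iterate_isHomogeneous {f : MvPolynomial (Fin n) k} {i j m : ℕ}
    (hf : f.IsHomogeneous i) (hm : m + j = i) : ((lowering k n d)^[j] f).IsHomogeneous m := by
  induction j generalizing m with
  | zero => simpa [show m = i from hm] using hf
  | succ j ih =>
    rw [Function.iterate_succ_apply']
    exact lowering_isHomogeneous (ih (by omega))

/-- Lowering the relation for `j` and commuting past `s` gives the next one. The scalar accumulates
the weights: `∑_{t ≤ j} (N - 2(i - t)) = (j + 1)(N - 2i + j)`. -/
theorem sum_X_mul_lowering_iterate {f : MvPolynomial (Fin n) k} {i : ℕ} (hf : f.IsHomogeneous i)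
    (hI : (∑ i, X i) * f ∈ powIdeal k n fun _ => d) {j : ℕ} (hj : j ≤ i) :
    (∑ i, X i) * (lowering k n d)^[j + 1] f +
      C (((j : k) + 1) * ((n : k) * (d - 1) - 2 * i + j)) * (lowering k n d)^[j] f ∈
        powIdeal k n fun _ => d := by
  induction j with
  | zero =>
    have h := lowering_mem_powIdeal hI
    rw [lowering_sum_X_mul hf] at h
    simpa using h
  | succ j ih =>
    have h := lowering_mem_powIdeal (ih (by omega))
    have hh := lowering_sum_X_mul (d := d) (lowering_iterate_isHomogeneous (d := d) (m := i - (j + 1))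
      hf (Nat.sub_add_cancel hj))
    rw [map_add, hh, ← smul_eq_C_mul ((lowering k n d)^[j] f), map_smul, smul_eq_C_mul,
      ← Function.iterate_succ_apply' (lowering k n d) _ f,
      ← Function.iterate_succ_apply' (lowering k n d) _ f, add_assoc, ← add_mul, ← C_add] at h
    convert h using 4
    push_cast [Nat.cast_sub hj]
    ring

theorem exists_sub_sum_X_pow_mul_mem {p : ℕ} [Fact p.Prime] [CharP k p] (hd : 0 < d)
    {f : MvPolynomial (Fin n) k} {i : ℕ} (hf : f.IsHomogeneous i)
    (hI : (∑ i, X i) * f ∈ powIdeal k n fun _ => d) (hi : 2 * i + 1 ≤ n * (d - 1))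
    (hi' : n * (d - 1) ≤ 2 * i + 2) (hp : i + 1 < p) {j : ℕ} (hj : j ≤ i) :
    ∃ c : k, f - C c * ((∑ i, X i) ^ j * (lowering k n d)^[j] f) ∈ powIdeal k n fun _ => d := by
  induction j with
  | zero => exact ⟨1, by simp⟩
  | succ j ih =>
    obtain ⟨c, hc⟩ := ih (by omega)
    have h := sum_X_mul_lowering_iterate hf hI (show j ≤ i by omega)
    set b : k := ((j : k) + 1) * ((n : k) * (d - 1) - 2 * i + j) with hb
    have hb0 : b ≠ 0 := by
      have : b = (((j + 1) * (n * (d - 1) - 2 * i + j) : ℕ) : k) := by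
        rw [hb]
        push_cast [Nat.cast_sub (show 2 * i ≤ n * (d - 1) by omega), Nat.cast_sub hd]
        ring
      rw [this, Ne, CharP.cast_eq_zero_iff k p, (Fact.out : p.Prime).dvd_mul]
      -- Since `N - 2i` is 1 or 2 and `j + 1 ≤ i`, both factors lie between 1 and `i + 1 < p`.
      rintro (h | h) <;> exact Nat.not_dvd_of_pos_of_lt (by omega) (by omega) h
    refine ⟨-(c * b⁻¹), ?_⟩
    have h2 := Ideal.add_mem _ hc (Ideal.mul_mem_left _ (C (c * b⁻¹) * (∑ i, X i) ^ j) h)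
    have hbb : (C b * C b⁻¹ : MvPolynomial (Fin n) k) = 1 := by
      rw [← C_mul, mul_inv_cancel₀ hb0, C_1]
    convert h2 using 1
    simp only [C_mul, C_neg]
    linear_combination (- C c * (∑ i, X i) ^ j * (lowering k n d)^[j] f) * hbb

theorem mem_powIdeal_of_sum_X_mul_mem_middle {p : ℕ} [Fact p.Prime] [CharP k p] (hd : 0 < d)
    {f : MvPolynomial (Fin n) k} {i : ℕ} (hf : f.IsHomogeneous i)
    (hI : (∑ i, X i) * f ∈ powIdeal k n fun _ => d) (hi : 2 * i + 1 ≤ n * (d - 1))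
    (hi' : n * (d - 1) ≤ 2 * i + 2) (hp : i + 1 < p) : f ∈ powIdeal k n fun _ => d := by
  obtain ⟨c, hc⟩ := exists_sub_sum_X_pow_mul_mem hd hf hI hi hi' hp le_rfl
  -- After `i` lowerings only a constant remains, so `f` is `b * s^i` modulo `I`.
  have h0 := lowering_iterate_isHomogeneous (d := d) hf (zero_add i)
  rw [← totalDegree_zero_iff_isHomogeneous, totalDegree_eq_zero_iff_eq_C] at h0
  rw [h0] at hc
  set b := c * coeff 0 ((lowering k n d)^[i] f) with hb
  have hs : C b * (∑ i, X i) ^ (i + 1) ∈ powIdeal k n fun _ => d := by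
    convert Ideal.sub_mem _ hI (Ideal.mul_mem_left _ (∑ i, X i) hc) using 1
    rw [hb, C_mul]
    ring
  by_cases hb0 : b = 0
  · convert hc using 1
    rw [mul_left_comm, ← C_mul, ← hb, hb0, C_0, mul_zero, sub_zero]
  · refine absurd ?_ (sum_X_pow_notMem (k := k) (n := n) hd hp (by omega : i + 1 ≤ n * (d - 1)))
    convert Ideal.mul_mem_left _ (C b⁻¹) hs using 1
    rw [← mul_assoc, ← C_mul, inv_mul_cancel₀ hb0, C_1, one_mul]

/-- The socle of the quotient is spanned by the monomial with all exponents `d - 1`; any other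
surviving monomial has an exponent with room to grow. -/
theorem mem_powIdeal_of_forall_X_mul_mem {f : MvPolynomial (Fin n) k} {i : ℕ}
    (hf : f.IsHomogeneous i) (hi : i < n * (d - 1)) (h : ∀ j, X j * f ∈ powIdeal k n fun _ => d) :
    f ∈ powIdeal k n fun _ => d := by
  rw [mem_powIdeal_iff]
  intro e he
  by_cases hei : e.degree = i
  · obtain ⟨j, hj⟩ : ∃ j, e j < d - 1 := by
      by_contra! h
      have := Finset.card_nsmul_le_sum Finset.univ e (d - 1) fun i _ => h i
      rw [← Finsupp.degree_eq_sum, hei] at this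
      simp at this
      omega
    rw [← coeff_X_mul e j f]
    refine mem_powIdeal_iff.1 (h j) _ fun l => ?_
    rcases eq_or_ne l j with rfl | hl
    · simp; omega
    · simpa [Finsupp.single_eq_of_ne hl] using he l
  · exact hf.coeff_eq_zero hei

theorem mem_powIdeal_of_sum_X_mul_mem {p : ℕ} [Fact p.Prime] [CharP k p] (hd : 0 < d)
    (hp : n * (d - 1) + 2 ≤ 2 * p) {f : MvPolynomial (Fin n) k} {i : ℕ} (hf : f.IsHomogeneous i)
    (hI : (∑ i, X i) * f ∈ powIdeal k n fun _ => d) (hi : 2 * i + 1 ≤ n * (d - 1)) :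
    f ∈ powIdeal k n fun _ => d := by
  by_cases hi' : n * (d - 1) ≤ 2 * i + 2
  · exact mem_powIdeal_of_sum_X_mul_mem_middle hd hf hI hi hi' (by omega)
  -- Multiples of `f` by variables are again killed by `s`, one degree closer to the middle.
  · refine mem_powIdeal_of_forall_X_mul_mem hf (by omega) fun j => ?_
    refine mem_powIdeal_of_sum_X_mul_mem hd hp (i := 1 + i) ((isHomogeneous_X k j).mul hf) ?_
      (by omega)
    rw [mul_left_comm]
    exact Ideal.mul_mem_left _ _ hI
termination_by n * (d - 1) - i

/-! ### The colon ideal -/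

theorem rename_succ_mem_powIdeal {f : MvPolynomial (Fin n) k} (hf : f ∈ powIdeal k n fun _ => d) :
    rename Fin.succ f ∈ powIdeal k (n + 1) fun _ => d := by
  have h : powIdeal k n (fun _ => d) ≤
      (powIdeal k (n + 1) fun _ => d).comap (rename Fin.succ : _ →ₐ[k] _) := by
    rw [powIdeal, Ideal.span_le]
    rintro _ ⟨i, rfl⟩
    rw [SetLike.mem_coe, Ideal.mem_comap, map_pow, rename_X]
    exact Ideal.subset_span ⟨i.succ, rfl⟩
  exact h hf

/-- With a new variable `x₀`, put `g = f (x₀^d - (-s)^d) / (x₀ + s)`. Then `(x₀ + s) g` lies in the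
ideal in `n + 1` variables, hence so does `g`, and `f` is recovered as its coefficient at
`x₀^(d-1)`. -/
theorem mem_powIdeal_of_sum_X_pow_mul_mem {p : ℕ} [Fact p.Prime] [CharP k p] (hd : 0 < d)
    (hp : (n + 1) * (d - 1) + 2 ≤ 2 * p) {f : MvPolynomial (Fin n) k} {i : ℕ}
    (hf : f.IsHomogeneous i) (hI : (∑ i, X i) ^ d * f ∈ powIdeal k n fun _ => d)
    (hi : 2 * i + d ≤ n * (d - 1)) : f ∈ powIdeal k n fun _ => d := by
  set s : MvPolynomial (Fin (n + 1)) k := ∑ i : Fin n, X i.succ with hs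
  have hsr : rename Fin.succ (∑ i, X i : MvPolynomial (Fin n) k) = s := by simp [hs]
  set g : MvPolynomial (Fin (n + 1)) k :=
    (∑ j ∈ Finset.range d, X 0 ^ j * (-s) ^ (d - 1 - j)) * rename Fin.succ f with hg
  have hgI : (∑ i, X i) * g ∈ powIdeal k (n + 1) fun _ => d := by
    have h : (∑ i, X i) * g =
        X 0 ^ d * rename Fin.succ f - (-1) ^ d * rename Fin.succ ((∑ i, X i) ^ d * f) := by
      rw [Fin.sum_univ_succ, ← hs, map_mul, map_pow, hsr, hg]
      linear_combination rename Fin.succ f * geom_sum₂_mul (X 0) (-s) d -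
        rename Fin.succ f * neg_pow s d
    rw [h]
    exact Ideal.sub_mem _ (Ideal.mul_mem_right _ _ (Ideal.subset_span ⟨0, rfl⟩))
      (Ideal.mul_mem_left _ _ (rename_succ_mem_powIdeal hI))
  have hgh : g.IsHomogeneous (d - 1 + i) := by
    refine (IsHomogeneous.sum _ _ _ fun j hj => ?_).mul hf.rename_isHomogeneous
    have hs1 : (-s).IsHomogeneous 1 := (IsHomogeneous.sum _ _ _ fun i _ => isHomogeneous_X k _).neg
    have := ((isHomogeneous_X k (0 : Fin (n + 1))).pow j).mul (hs1.pow (d - 1 - j))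
    rwa [one_mul, one_mul, Nat.add_sub_cancel' (by have := Finset.mem_range.1 hj; omega)] at this
  -- The bound `2(d - 1 + i) + 1 ≤ (n + 1)(d - 1)` is equivalent to `hi`.
  have hgm := mem_powIdeal_of_sum_X_mul_mem hd hp hgh hgI (by rw [add_mul]; omega)
  rw [mem_powIdeal_iff] at hgm ⊢
  intro e he
  have hfs : finSuccEquiv k n g = ∑ j ∈ Finset.range d,
      Polynomial.X ^ j * Polynomial.C ((-∑ i, X i) ^ (d - 1 - j) * f) := by
    have h1 : finSuccEquiv k n s = Polynomial.C (∑ i, X i) := by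
      simp [hs, finSuccEquiv_X_succ]
    have h2 (f) : finSuccEquiv k n (rename Fin.succ f) = Polynomial.C f := by
      induction f using MvPolynomial.induction_on with
      | C a => simp [finSuccEquiv_apply]
      | add f g hf hg => simp [hf, hg]
      | mul_X f i hf => simp [hf, finSuccEquiv_X_succ]
    rw [hg, map_mul, h2, map_sum, Finset.sum_mul]
    refine Finset.sum_congr rfl fun j _ => ?_
    rw [map_mul, map_pow, map_pow, map_neg, h1, finSuccEquiv_X_zero]
    simp [mul_assoc]
  have hc : (finSuccEquiv k n g).coeff (d - 1) = f := by
    rw [hfs, Polynomial.finsetSum_coeff, Finset.sum_eq_single (d - 1)]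
    · simp
    · intro j _ hj
      rw [mul_comm, Polynomial.coeff_C_mul, Polynomial.coeff_X_pow, if_neg hj.symm, mul_zero]
    · intro h
      exact absurd (Finset.mem_range.2 (by omega)) h
  rw [← hc, finSuccEquiv_coeff_coeff]
  refine hgm _ fun i => ?_
  refine Fin.cases ?_ (fun i => ?_) i
  · simpa using hd
  · simpa using he i

theorem stanIneq_of_le {p : ℕ} [Fact p.Prime] [CharP k p] (hd : 0 < d)
    (hp : (n + 1) * (d - 1) + 2 ≤ 2 * p) : StanIneq k n (fun _ => d) d := by
  rintro i hi u hu ⟨f, hf, rfl⟩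
  refine Ideal.Quotient.eq_zero_iff_mem.2 (mem_powIdeal_of_sum_X_pow_mul_mem hd hp hf ?_ ?_)
  · obtain ⟨g, hg, hgf⟩ :=
      (Ideal.mem_map_iff_of_surjective _ Ideal.Quotient.mk_surjective).1 hu
    rw [Submodule.mem_colon_singleton, smul_eq_mul] at hg
    have hgf' := Ideal.mul_mem_right ((∑ i, X i) ^ d) _ (Ideal.Quotient.eq.1 hgf)
    convert Ideal.sub_mem _ hg hgf' using 1
    ring
  · obtain ⟨c, rfl⟩ : ∃ c, d = c + 1 := ⟨d - 1, by omega⟩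
    simp only [MN, Finset.sum_const, Finset.card_univ, Fintype.card_fin, nsmul_eq_mul] at hi
    have h2 : 2 * (i : ℤ) + (c + 1 : ℕ) ≤ (n : ℤ) * (c + 1 : ℕ) - n := by omega
    zify
    push_cast at h2 ⊢
    linarith

/-! ### Surjectivity above the middle degree -/

/-- Duality: a functional vanishing on `s A_i` is encoded by a polynomial `v` of the complementary
degree `N - (i + 1)` with `s v ∈ I`. Injectivity there forces the functional to vanish on `A_(i+1)`.
-/
theorem mem_map_mulLeft_sum_X {p : ℕ} [Fact p.Prime] [CharP k p] (hd : 0 < d)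
    (hp : n * (d - 1) + 2 ≤ 2 * p) {i : ℕ} (hi : n * (d - 1) ≤ 2 * i) {y : CIAlg k n fun _ => d}
    (hy : y ∈ ciGrading k n (fun _ => d) (i + 1)) :
    y ∈ (ciGrading k n (fun _ => d) i).map
      (LinearMap.mulLeft k (Ideal.Quotient.mk (powIdeal k n fun _ => d) (∑ i, X i))) := by
  by_contra hyW
  obtain ⟨φ, hφy, hφ⟩ := Submodule.exists_le_ker_of_notMem hyW
  set ψ : MvPolynomial (Fin n) k →ₗ[k] k :=
    φ ∘ₗ (Ideal.Quotient.mkₐ k (powIdeal k n fun _ => d)).toLinearMap with hψ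
  have hψI {f} (hf : f ∈ powIdeal k n fun _ => d) : ψ f = 0 := by
    change φ (Ideal.Quotient.mk _ f) = 0
    rw [Ideal.Quotient.eq_zero_iff_mem.2 hf, map_zero]
  have hψs {f} (hf : f.IsHomogeneous i) : ψ ((∑ i, X i) * f) = 0 :=
    hφ ⟨Ideal.Quotient.mk _ f, mk_mem_ciGrading k n _ hf, (map_mul _ _ _).symm⟩
  set D : Fin n →₀ ℕ := Finsupp.equivFunOnFinite.symm fun _ => d - 1 with hD
  have hDdeg : D.degree = n * (d - 1) := by simp [Finsupp.degree_eq_sum, hD]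
  have hle (e : Fin n →₀ ℕ) : e ≤ D ↔ ∀ i, e i < d := by
    refine forall_congr' fun i => ?_
    simp only [hD, Finsupp.equivFunOnFinite_symm_apply_apply]
    omega
  suffices h : ∀ e, e.degree = i + 1 → ψ (monomial e 1) = 0 by
    obtain ⟨f, hf, rfl⟩ := hy
    refine hφy ?_
    change ψ f = 0
    rw [f.as_sum, map_sum]
    refine Finset.sum_eq_zero fun e he => ?_
    rw [← mul_one (coeff e f), ← smul_eq_mul, ← smul_monomial, map_smul,
      h e (by rw [Finsupp.degree_eq_weight_one]; exact hf (mem_support_iff.1 he)), smul_zero]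
  intro e he
  by_cases heD : e ≤ D
  swap
  · refine hψI (mem_powIdeal_iff.2 fun e' he' => ?_)
    rw [coeff_monomial, if_neg]
    rintro rfl
    exact heD ((hle e).2 he')
  have hdeg {a : Fin n →₀ ℕ} (ha : a ≤ D) : (D - a).degree + a.degree = n * (d - 1) := by
    rw [← map_add, tsub_add_cancel_of_le ha, hDdeg]
  set S : Finset (Fin n →₀ ℕ) := (Finset.Iic D).filter fun a => (D - a).degree = i + 1
  set v : MvPolynomial (Fin n) k := ∑ a ∈ S, monomial a (ψ (monomial (D - a) 1)) with hv
  have hS {a} : a ∈ S ↔ a ≤ D ∧ (D - a).degree = i + 1 := by simp [S]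
  have hcv (a) : v.coeff a = if a ∈ S then ψ (monomial (D - a) 1) else 0 := by
    simp [hv, coeff_sum, coeff_monomial]
  have hin := hdeg heD
  have hvh : v.IsHomogeneous (n * (d - 1) - (i + 1)) := by
    refine IsHomogeneous.sum _ _ _ fun a ha => isHomogeneous_monomial _ ?_
    have := hdeg (hS.1 ha).1
    have := (hS.1 ha).2
    omega
  have hvI : (∑ i, X i) * v ∈ powIdeal k n fun _ => d := by
    rw [mem_powIdeal_iff]
    intro a ha
    have haD := (hle a).2 ha
    by_cases hai : (D - a).degree = i
    -- The coefficient of `s v` at `a` is `ψ (s x^(D-a))`, compared variable by variable.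
    · rw [← hψs (isHomogeneous_monomial (1 : k) hai), Finset.sum_mul, Finset.sum_mul, coeff_sum,
        map_sum]
      refine Finset.sum_congr rfl fun j _ => ?_
      rw [coeff_X_mul', X, monomial_mul, one_mul]
      split_ifs with hj
      · obtain ⟨b, rfl⟩ : ∃ b, a = b + Finsupp.single j 1 :=
          ⟨a - Finsupp.single j 1, (tsub_add_cancel_of_le (Finsupp.single_le_iff.2
            (Nat.one_le_iff_ne_zero.2 (Finsupp.mem_support_iff.1 hj)))).symm⟩
        have hb : D - b = Finsupp.single j 1 + (D - (b + Finsupp.single j 1)) := by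
          rw [tsub_add_eq_tsub_tsub, add_tsub_cancel_of_le]
          rw [le_tsub_iff_left (le_self_add.trans haD)]
          exact haD
        rw [add_tsub_cancel_right, hcv, if_pos, hb]
        rw [hS, hb, map_add, hai, Finsupp.degree_single, add_comm]
        exact ⟨le_self_add.trans haD, rfl⟩
      -- If `a j = 0`, then `x_j x^(D-a)` is divisible by `x_j^d`, so both sides vanish.
      · refine (hψI (mem_powIdeal_iff.2 fun e' he' => ?_)).symm
        rw [coeff_monomial, if_neg]
        rintro rfl
        have := he' j
        rw [Finsupp.add_apply, Finsupp.single_eq_same, Finsupp.tsub_apply,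
          Finsupp.notMem_support_iff.1 hj] at this
        simp [hD] at this
        omega
    · refine (isHomogeneous_sum_X.mul hvh).coeff_eq_zero ?_
      have := hdeg haD
      omega
  have := mem_powIdeal_iff.1 (mem_powIdeal_of_sum_X_mul_mem hd hp hvh hvI (by omega)) (D - e)
    ((hle _).1 tsub_le_self)
  rwa [hcv, if_pos, tsub_tsub_cancel_of_le heD] at this
  rw [hS, tsub_tsub_cancel_of_le heD]
  exact ⟨tsub_le_self, he⟩

theorem hasWLP_of_le {p : ℕ} [Fact p.Prime] [CharP k p] (hd : 0 < d)
    (hp : n * (d - 1) + 2 ≤ 2 * p) : HasWLP (ciGrading k n fun _ => d) := by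
  refine ⟨⟨Ideal.Quotient.mk _ (∑ i, X i), mk_mem_ciGrading k n _ isHomogeneous_sum_X⟩,
    fun i => ?_⟩
  rcases Nat.lt_or_ge (2 * i) (n * (d - 1)) with hi | hi
  · left
    rw [injective_iff_map_eq_zero]
    rintro ⟨_, f, hf, rfl⟩ h
    refine Subtype.ext (Ideal.Quotient.eq_zero_iff_mem.2
      (mem_powIdeal_of_sum_X_mul_mem hd hp hf ?_ (by omega)))
    refine Ideal.Quotient.eq_zero_iff_mem.1 ?_
    rw [map_mul]
    exact congrArg Subtype.val h
  · right
    rintro ⟨y, hy⟩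
    obtain ⟨x, hx, hxy⟩ := mem_map_mulLeft_sum_X hd hp hi hy
    exact ⟨⟨x, hx⟩, Subtype.ext hxy⟩

end WeakLefschetz

theorem theorem3p8 (k : Type*) [Field k] (p : ℕ) (hp : 0 < p) [CharP k p]
    (n d : ℕ) (hd : 0 < d) (hn : 3 ≤ n)
    (h : ((n : ℤ) * ((d : ℤ) - 1) + 3) / 2 ≤ (p : ℤ)) :
    StanIneq k (n - 1) (fun _ => d) d ∧
      (Infinite k → HasWLP (ciGrading k n (fun _ => d))) := by
  have : Fact p.Prime := ⟨(CharP.char_is_prime_or_zero k p).resolve_right hp.ne'⟩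
  -- For integers, `⌊(N + 3)/2⌋ ≤ p` means `N + 3 ≤ 2p + 1`.
  have hp2 : n * (d - 1) + 2 ≤ 2 * p := by
    zify [hd]
    have : ((n * (d - 1 : ℤ)) + 3) / 2 ≤ p := h
    omega
  refine ⟨?_, fun _ => hasWLP_of_le hd hp2⟩
  obtain ⟨m, rfl⟩ : ∃ m, n = m + 1 := ⟨n - 1, by omega⟩
  exact stanIneq_of_le hd hp2
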